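/- Let $f(n,m)=\mathbb{E}(\max F)$, where $F$ is a random 2-SAT formula on $n$ Boolean variables consisting of $m$ clauses drawn independently and uniformly, with replacement, from the $4\binom n2$ proper 2-clauses (unordered pairs of literals on two distinct variables), and where $\max F$ is the maximum, over all truth assignments, of the number of clauses of $F$ that are satisfied. For sequences $u,v$ of real numbers with $v(n)>0$ for all large $n$, write $u(n)\lesssim v(n)$ if $\limsup_{n\to\infty}u(n)/v(n)\le 1$. Theorem. There are absolute constants $K$ and $c_0>0$ such that for every real $c\ge c_0$, as $n\to\infty$ with $c$ fixed, $f(n,\lfloor cn\rfloor)-\tfrac34cn$ is positive for all large $n$, and $$\Bigl(\sqrt c\;\frac{\sqrt8-\sqrt1}{3\sqrt\pi}-K\Bigr)n\;\lesssim\; f(n,\lfloor cn\rfloor)-\tfrac34\,cn\;\lesssim\;\Bigl(\sqrt c\,\sqrt{\tfrac{3\ln 2}{8}}\Bigr)n .$$ -/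

import Mathlib

open Filter

namespace Max2Sat

/-- A literal on the variables `X_i`, `i : Fin n`: the pair `(i, true)` is `X_i`, the pair
`(i, false)` is its complement. -/
abbrev Literal (n : ℕ) : Type := Fin n × Bool

/-- A proper 2-clause: an unordered pair of literals on two distinct variables. There are
`4 * n.choose 2` of them. -/
abbrev Clause (n : ℕ) : Type :=
  {C : Finset (Literal n) // C.card = 2 ∧ ∀ a ∈ C, ∀ b ∈ C, a.1 = b.1 → a = b}

/-- A 2-SAT formula with `n` variables and `m` clauses (repetitions allowed). -/
abbrev Formula (n m : ℕ) : Type := Fin m → Clause n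

instance (n m : ℕ) : Fintype (Formula n m) :=
  haveI : Fintype (Clause n) := inferInstance
  Pi.instFintype

/-- An assignment satisfies a clause if it makes at least one of its literals true. -/
def Satisfies {n : ℕ} (X : Fin n → Bool) (C : Clause n) : Prop :=
  ∃ l ∈ C.1, X l.1 = l.2

instance {n : ℕ} (X : Fin n → Bool) (C : Clause n) : Decidable (Satisfies X C) :=
  inferInstanceAs (Decidable (∃ l ∈ C.1, X l.1 = l.2))

/-- `F(X)`: the number of clauses of `F` satisfied by the assignment `X`. -/
def numSat {n m : ℕ} (F : Formula n m) (X : Fin n → Bool) : ℕ :=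
  (Finset.univ.filter fun j : Fin m => Satisfies X (F j)).card

/-- `max F`: the maximum over all assignments of the number of satisfied clauses. -/
def maxSat {n m : ℕ} (F : Formula n m) : ℕ :=
  Finset.univ.sup fun X : Fin n → Bool => numSat F X

/-- `f(n, m)`: the expectation of `max F` for `F` uniformly random among the formulas with `n`
variables and `m` clauses, i.e. for `m` independent uniformly random clauses. -/
noncomputable def expectedMax (n m : ℕ) : ℝ :=
  (∑ F : Formula n m, (maxSat F : ℝ)) / (Fintype.card (Formula n m) : ℝ)

/-- `u ≲ v`, asymptotic inequality: `limsup u / v ≤ 1`, for a comparison sequence `v` that is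
eventually positive. The limsup is taken in the extended reals, so that it always exists. -/
def AsympLE (u v : ℕ → ℝ) : Prop :=
  (∀ᶠ n in atTop, 0 < v n) ∧
    limsup (fun n => ((u n / v n : ℝ) : EReal)) atTop ≤ 1

end Max2Sat

/-! A random formula is a uniform multigraph of variable pairs with independent uniform signs on the
literals.

Upper bound: with the multigraph and the assignment fixed, the satisfied count is Bin(m, 3/4). Its
exponential moments for l ≥ 0 are sub-Gaussian with the true variance 3m/16 (`bernoulli_mgf_le`), so
a union bound over the 2^n assignments (`expect_select_le`), with l optimised, gives the constant.

Lower bound: set the variables in order, each to the sign of the derivative of the multilinear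
extension `phi`. The starting value is 3m/4 and step k gains |`grad`|/4. Resampling the signs at
variable k leaves the earlier steps unchanged and turns the derivative into a Rademacher sum, so
Khintchine's inequality with the Gaussian constant and an O(1) loss (`le_expect_abs_sum`) bounds the
gain below. The conditional variance is a weighted degree minus twice a bias created by the earlier
greedy choices. The degree has mean about (2m/n)(1 + k/n) and variance of at most the same order;
the biases have total size O(√(nm)) by a union bound over sign vectors. Both errors cost O(n),
absorbed in K. The integral of √(1 + x) over [0, 1], equal to (2/3)(√8 − 1), produces the leading
coefficient. -/

namespace Max2Sat

open MeasureTheory ProbabilityTheory Set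

/-! ### Integral representation of the absolute value and its Gaussian average. -/

/-- `cos u ≤ exp (-u² / 2)` for `|u| ≤ 1`. -/
lemma cos_le_exp_neg_sq_div_two {u : ℝ} (hu : |u| ≤ 1) : Real.cos u ≤ Real.exp (-u ^ 2 / 2) := by
  have h1 := (abs_le.mp (Real.cos_bound hu)).2
  rw [Even.pow_abs (by decide)] at h1
  have hy : u ^ 2 ≤ 1 := by rw [← sq_abs]; exact pow_le_one₀ (abs_nonneg u) hu
  -- The quartic coefficient 1/8 of the exponential beats 5/96 even after paying its remainder
  -- u^6/36 ≤ u^4/36.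
  have h2 : 1 - u ^ 2 / 2 + u ^ 4 * (5 / 96) ≤ Real.exp (-u ^ 2 / 2) := by
    have h := Real.exp_bound (x := -u ^ 2 / 2) (n := 3)
      (by rw [abs_le]; constructor <;> nlinarith [sq_nonneg u]) (by norm_num)
    have h' := (abs_le.mp h).1
    have ha : |-u ^ 2 / 2| = u ^ 2 / 2 := by
      rw [neg_div, abs_neg, abs_of_nonneg (by positivity)]
    rw [ha] at h'
    norm_num [Finset.sum_range_succ, Nat.factorial] at h'
    have : u ^ 6 ≤ u ^ 4 := by nlinarith [sq_nonneg (u ^ 2)]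
    nlinarith [sq_nonneg (u ^ 2)]
  linarith

/-- The kernel whose integral over `(0, ∞)` represents the absolute value. -/
noncomputable def absKernel (x t : ℝ) : ℝ := (1 - Real.cos (x * t)) / t ^ 2

lemma absKernel_nonneg (x t : ℝ) : 0 ≤ absKernel x t :=
  div_nonneg (by linarith [Real.cos_le_one (x * t)]) (sq_nonneg t)

lemma measurable_absKernel : Measurable (Function.uncurry absKernel) := by
  unfold absKernel Function.uncurry
  fun_prop

lemma integrableOn_inv_sq {a : ℝ} (ha : 0 < a) :
    IntegrableOn (fun t : ℝ => 1 / t ^ 2) (Ioi a) := by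
  have h := integrableOn_Ioi_rpow_of_lt (a := -2) (by norm_num) ha
  refine h.congr_fun (fun t ht => ?_) measurableSet_Ioi
  have : (0 : ℝ) < t := ha.trans ht
  simp [Real.rpow_neg this.le]

lemma integral_inv_sq {a : ℝ} (ha : 0 < a) : ∫ t in Ioi a, 1 / t ^ 2 = 1 / a := by
  have h := integral_Ioi_rpow_of_lt (a := -2) (by norm_num) ha
  rw [setIntegral_congr_fun (g := fun t : ℝ => 1 / t ^ 2) measurableSet_Ioi] at h
  · rw [h]; norm_num [Real.rpow_neg_one]
  · intro t ht
    have : (0 : ℝ) < t := ha.trans ht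
    simp [Real.rpow_neg this.le]

lemma integrableOn_div_sq {f : ℝ → ℝ} (hf : Measurable f) {A B : ℝ}
    (h0 : ∀ t, 0 ≤ f t) (hA : ∀ t, f t ≤ A * t ^ 2) (hB : ∀ t, f t ≤ B) :
    IntegrableOn (fun t => f t / t ^ 2) (Ioi 0) := by
  rw [← Ioc_union_Ioi_eq_Ioi zero_le_one]
  refine IntegrableOn.union ?_ ?_
  · refine Measure.integrableOn_of_bounded (M := A) (by simp)
      (hf.div (by fun_prop)).aestronglyMeasurable ?_
    refine (ae_restrict_iff' measurableSet_Ioc).2 (Eventually.of_forall fun t ht => ?_)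
    rw [Real.norm_of_nonneg (div_nonneg (h0 t) (sq_nonneg t)),
      div_le_iff₀ (pow_pos ht.1 2)]
    exact hA t
  · refine Integrable.mono' ((integrableOn_inv_sq one_pos).const_mul B)
      (hf.div (by fun_prop)).aestronglyMeasurable ?_
    refine Eventually.of_forall fun t => ?_
    rw [Real.norm_of_nonneg (div_nonneg (h0 t) (sq_nonneg t)), mul_one_div]
    exact div_le_div_of_nonneg_right (hB t) (sq_nonneg t)

lemma integrableOn_absKernel (x : ℝ) : IntegrableOn (absKernel x) (Ioi 0) := by
  refine integrableOn_div_sq (f := fun t => 1 - Real.cos (x * t)) (A := x ^ 2 / 2) (B := 2)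
    (by fun_prop) (fun t => ?_) (fun t => ?_) (fun t => ?_)
  · linarith [Real.cos_le_one (x * t)]
  · nlinarith [Real.one_sub_sq_div_two_le_cos (x := x * t)]
  · linarith [Real.neg_one_le_cos (x * t)]

/-- The normalizing constant of `absKernel`. -/
noncomputable def absConst : ℝ := ∫ t in Ioi 0, absKernel 1 t

/-- Substituting t ↦ xt pulls out |x|. Only positivity of `absConst` is ever needed, since it
cancels from the leading term of Khintchine's inequality. -/
lemma integral_absKernel (x : ℝ) : ∫ t in Ioi 0, absKernel x t = |x| * absConst := by
  have key : ∀ x : ℝ, 0 < x → ∫ t in Ioi 0, absKernel x t = x * absConst := by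
    intro x hx
    have h := integral_comp_mul_left_Ioi (absKernel 1) 0 hx
    rw [mul_zero] at h
    have h2 : ∀ t, absKernel x t = x ^ 2 * absKernel 1 (x * t) := by
      intro t
      unfold absKernel
      rw [one_mul, mul_pow]
      field_simp
    simp_rw [h2]
    rw [integral_const_mul, h, absConst, smul_eq_mul]
    field_simp
  rcases lt_trichotomy x 0 with hx | hx | hx
  · have h2 : ∀ t, absKernel x t = absKernel (-x) t := by
      intro t; simp [absKernel]
    simp_rw [h2]
    rw [key _ (by linarith), abs_of_neg hx]
  · simp [hx, absKernel]
  · rw [key x hx, abs_of_pos hx]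

lemma absConst_pos : 0 < absConst := by
  unfold absConst
  rw [setIntegral_pos_iff_support_of_nonneg_ae
    (Eventually.of_forall fun t => absKernel_nonneg 1 t) (integrableOn_absKernel 1)]
  refine lt_of_lt_of_le ?_ (measure_mono (s := Ioo 0 1) ?_)
  · simp
  · intro t ht
    refine ⟨?_, ht.1⟩
    rw [Function.mem_support, absKernel]
    refine (div_pos ?_ (pow_pos ht.1 2)).ne'
    have : Real.cos (1 * t) < Real.cos 0 :=
      Real.cos_lt_cos_of_nonneg_of_le_pi_div_two le_rfl
        (by linarith [Real.pi_gt_three, ht.2]) (by linarith [ht.1])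
    rw [Real.cos_zero] at this
    linarith

lemma integral_abs_gaussianReal : ∫ x, |x| ∂gaussianReal 0 1 = Real.sqrt (2 / Real.pi) := by
  rw [integral_gaussianReal_eq_integral_smul (by norm_num)]
  have h : ∀ x : ℝ, gaussianPDFReal 0 1 x • |x|
      = (fun y => (Real.sqrt (2 * Real.pi))⁻¹ * (y ^ (1 : ℝ) * Real.exp (-(1 / 2) * y ^ (2 : ℝ)))) |x| := by
    intro x
    simp [gaussianPDFReal]
    ring_nf
  simp_rw [h]
  rw [integral_comp_abs (f := fun y => (Real.sqrt (2 * Real.pi))⁻¹ * (y ^ (1 : ℝ) * Real.exp (-(1 / 2) * y ^ (2 : ℝ)))),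
    integral_const_mul, integral_rpow_mul_exp_neg_mul_rpow (by norm_num) (by norm_num) (by norm_num)]
  norm_num
  have h2 : Real.sqrt 2 * Real.sqrt 2 = 2 := Real.mul_self_sqrt (by norm_num)
  have hp : 0 < Real.sqrt Real.pi := Real.sqrt_pos.2 Real.pi_pos
  have : 0 < Real.sqrt 2 := by positivity
  field_simp
  nlinarith

lemma integral_cos_gaussianReal (t : ℝ) :
    ∫ x, Real.cos (x * t) ∂gaussianReal 0 1 = Real.exp (-t ^ 2 / 2) := by
  have h := charFun_gaussianReal (μ := 0) (v := 1) t
  rw [charFun_apply_real] at h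
  have h' := congrArg Complex.re h
  have hint : Integrable (fun x : ℝ => Complex.exp (t * x * Complex.I)) (gaussianReal 0 1) := by
    refine Integrable.of_bound (C := 1) (by fun_prop) (Eventually.of_forall fun x => ?_)
    rw [← Complex.ofReal_mul, Complex.norm_exp_ofReal_mul_I]
  have h3 := integral_re (𝕜 := ℂ) hint
  simp only [RCLike.re_eq_complex_re] at h3
  rw [← h3] at h'
  have e1 : ∀ x : ℝ, (Complex.exp (t * x * Complex.I)).re = Real.cos (x * t) := by
    intro x
    rw [← Complex.ofReal_mul, Complex.exp_ofReal_mul_I_re, mul_comm]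
  simp_rw [e1] at h'
  rw [h']
  have e2 : ((t : ℂ) * ((0 : ℝ) : ℂ) * Complex.I - ((1 : NNReal) : ℝ) * (t : ℂ) ^ 2 / 2)
      = ((-t ^ 2 / 2 : ℝ) : ℂ) := by
    push_cast; ring
  convert Complex.exp_ofReal_re (-t ^ 2 / 2) using 2
  rw [← e2]

lemma integrableOn_one_sub_exp (v : ℝ) (hv : 0 ≤ v) :
    IntegrableOn (fun t : ℝ => (1 - Real.exp (-v * t ^ 2 / 2)) / t ^ 2) (Ioi 0) := by
  refine integrableOn_div_sq (A := v / 2) (B := 1) (by fun_prop) (fun t => ?_) (fun t => ?_)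
    (fun t => ?_)
  · have : Real.exp (-v * t ^ 2 / 2) ≤ 1 := Real.exp_le_one_iff.2 (by nlinarith [mul_nonneg hv (sq_nonneg t)])
    linarith
  · linarith [Real.add_one_le_exp (-v * t ^ 2 / 2)]
  · linarith [Real.exp_pos (-v * t ^ 2 / 2)]

/-- Averaging the kernel representation of |x| over a standard Gaussian and applying Fubini replaces
the cosine by the Gaussian characteristic function. -/
lemma integral_one_sub_exp_one :
    ∫ t in Ioi (0 : ℝ), (1 - Real.exp (-t ^ 2 / 2)) / t ^ 2
      = Real.sqrt (2 / Real.pi) * absConst := by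
  have hint : Integrable (Function.uncurry absKernel)
      ((gaussianReal 0 1).prod (volume.restrict (Ioi (0 : ℝ)))) := by
    rw [integrable_prod_iff measurable_absKernel.aestronglyMeasurable]
    refine ⟨Eventually.of_forall fun x => integrableOn_absKernel x, ?_⟩
    have h : ∀ x, ∫ t in Ioi 0, ‖Function.uncurry absKernel (x, t)‖ = |x| * absConst := by
      intro x
      rw [← integral_absKernel]
      refine integral_congr_ae (Eventually.of_forall fun t => ?_)
      simp only [Function.uncurry]
      exact Real.norm_of_nonneg (absKernel_nonneg x t)
    simp_rw [h]
    exact ((memLp_one_iff_integrable.1 (memLp_id_gaussianReal 1)).abs).mul_const _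
  have h := integral_integral_swap hint
  simp_rw [integral_absKernel] at h
  rw [integral_mul_const, integral_abs_gaussianReal] at h
  rw [h]
  refine integral_congr_ae (Eventually.of_forall fun t => ?_)
  simp only [absKernel]
  rw [integral_div, integral_sub (integrable_const _), integral_cos_gaussianReal]
  · simp
  · exact Integrable.of_bound (C := 1) (by fun_prop)
      (Eventually.of_forall fun x => by simpa using Real.abs_cos_le_one _)

lemma integral_one_sub_exp (v : ℝ) (hv : 0 ≤ v) :
    ∫ t in Ioi (0 : ℝ), (1 - Real.exp (-v * t ^ 2 / 2)) / t ^ 2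
      = Real.sqrt (2 / Real.pi) * Real.sqrt v * absConst := by
  rcases hv.eq_or_lt with rfl | hv
  · simp
  have hs : 0 < Real.sqrt v := Real.sqrt_pos.2 hv
  have h := integral_comp_mul_left_Ioi (fun t : ℝ => (1 - Real.exp (-t ^ 2 / 2)) / t ^ 2) 0 hs
  rw [mul_zero, integral_one_sub_exp_one] at h
  have h2 : ∀ t : ℝ, (1 - Real.exp (-v * t ^ 2 / 2)) / t ^ 2
      = v * ((1 - Real.exp (-(Real.sqrt v * t) ^ 2 / 2)) / (Real.sqrt v * t) ^ 2) := by
    intro t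
    rw [mul_pow, Real.sq_sqrt hv.le]
    field_simp
  simp_rw [h2]
  rw [integral_const_mul, h, smul_eq_mul]
  nth_rewrite 1 [← Real.mul_self_sqrt hv.le]
  field_simp

end Max2Sat

/-! ### Khintchine, maximal and exponential moment inequalities. -/

namespace Max2Sat

open MeasureTheory ProbabilityTheory Set
open scoped BigOperators

lemma expect_prod {ι α K : Type*} [Fintype ι] [DecidableEq ι] [Fintype α] [Field K] [CharZero K]
    (f : ι → α → K) :
    𝔼 e : ι → α, ∏ i, f i (e i) = ∏ i, 𝔼 a, f i a := by
  simp_rw [Fintype.expect_eq_sum_div_card]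
  rw [Finset.prod_div_distrib, Finset.prod_univ_sum]
  simp

lemma expect_intUnits {K : Type*} [Field K] [CharZero K] (f : ℤˣ → K) :
    𝔼 e, f e = (f 1 + f (-1)) / 2 := by
  rw [Fintype.expect_eq_sum_div_card]
  simp

/-- The sign `±1` as a real number. -/
abbrev sgn (u : ℤˣ) : ℝ := ((u : ℤ) : ℝ)

lemma sgn_sq (u : ℤˣ) : sgn u ^ 2 = 1 := by
  rcases Int.units_eq_one_or u with rfl | rfl <;> simp [sgn]

lemma expect_cos {ι : Type*} [Fintype ι] [DecidableEq ι] (c : ι → ℝ) (t : ℝ) :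
    𝔼 e : ι → ℤˣ, Real.cos ((∑ i, sgn (e i) * c i) * t) = ∏ i, Real.cos (c i * t) := by
  have h := expect_prod (K := ℂ) (fun (i : ι) (u : ℤˣ) => Complex.exp (((sgn u * c i * t : ℝ) : ℂ) * Complex.I))
  have h1 : ∀ e : ι → ℤˣ, ∏ i, Complex.exp (((sgn (e i) * c i * t : ℝ) : ℂ) * Complex.I)
      = Complex.exp ((((∑ i, sgn (e i) * c i) * t : ℝ) : ℂ) * Complex.I) := by
    intro e
    rw [← Complex.exp_sum, ← Finset.sum_mul, ← Complex.ofReal_sum, Finset.sum_mul]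
  have h2 : ∀ i : ι, 𝔼 u : ℤˣ, Complex.exp (((sgn u * c i * t : ℝ) : ℂ) * Complex.I)
      = ((Real.cos (c i * t) : ℝ) : ℂ) := by
    intro i
    rw [expect_intUnits, Complex.ofReal_cos, Complex.cos]
    simp [sgn]
  simp_rw [h1, h2] at h
  rw [← Complex.ofReal_prod] at h
  have h' := congrArg Complex.re h
  rw [Complex.ofReal_re] at h'
  rw [← h', Fintype.expect_eq_sum_div_card, Fintype.expect_eq_sum_div_card,
    ← Complex.ofReal_natCast, Complex.div_ofReal_re, Complex.re_sum]
  congr 1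
  exact Finset.sum_congr rfl fun e _ => (Complex.exp_ofReal_mul_I_re _).symm

/-- Khintchine's inequality with the Gaussian constant, for weights bounded by `2`, up to an
additive constant. -/
lemma le_expect_abs_sum {ι : Type*} [Fintype ι] [DecidableEq ι] (c : ι → ℝ)
    (hc : ∀ i, |c i| ≤ 2) :
    Real.sqrt (2 / Real.pi) * Real.sqrt (∑ i, c i ^ 2) - 2 / absConst
      ≤ 𝔼 e : ι → ℤˣ, |∑ i, sgn (e i) * c i| := by
  set v := ∑ i, c i ^ 2 with hv
  have hv0 : 0 ≤ v := Finset.sum_nonneg fun i _ => sq_nonneg _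
  have hker : ∀ t, 𝔼 e : ι → ℤˣ, absKernel (∑ i, sgn (e i) * c i) t
      = (1 - ∏ i, Real.cos (c i * t)) / t ^ 2 := by
    intro t
    simp_rw [absKernel]
    rw [← Finset.expect_div, Finset.expect_sub_distrib, expect_cos, Fintype.expect_const]
  have hI : (𝔼 e : ι → ℤˣ, |∑ i, sgn (e i) * c i|) * absConst
      = ∫ t in Ioi 0, (1 - ∏ i, Real.cos (c i * t)) / t ^ 2 := by
    simp_rw [← hker]
    simp_rw [Fintype.expect_eq_sum_div_card]
    rw [integral_div, integral_finsetSum _ fun e _ => integrableOn_absKernel _]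
    simp_rw [integral_absKernel]
    rw [← Finset.sum_mul, div_mul_eq_mul_div]
  have hint : IntegrableOn (fun t => (1 - ∏ i, Real.cos (c i * t)) / t ^ 2) (Ioi 0) := by
    simp_rw [← hker, Fintype.expect_eq_sum_div_card]
    exact (integrable_finsetSum _ fun e _ => integrableOn_absKernel _).div_const _
  have hprod1 : ∀ t, ∏ i, Real.cos (c i * t) ≤ 1 := fun t =>
    (le_abs_self _).trans <| by
      rw [Finset.abs_prod]
      exact Finset.prod_le_one (fun _ _ => abs_nonneg _) fun _ _ => Real.abs_cos_le_one _
  -- The cut at 1/2 makes |c i * t| ≤ 1 below it, where each cosine is dominated by a Gaussian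
  -- factor. Above it the integrand is only used to be nonnegative, which loses at most 2, the
  -- integral of 1/t² over (1/2, ∞).
  have htail : IntegrableOn ((Ioi (1 / 2 : ℝ)).indicator fun t : ℝ => 1 / t ^ 2) (Ioi 0) :=
    ((integrableOn_inv_sq (by norm_num : (0 : ℝ) < 1 / 2)).integrable_indicator
      measurableSet_Ioi).integrableOn
  have hle : (∫ t in Ioi (0 : ℝ), (1 - Real.exp (-v * t ^ 2 / 2)) / t ^ 2)
      - ∫ t in Ioi (0 : ℝ), (Ioi (1 / 2 : ℝ)).indicator (fun t : ℝ => 1 / t ^ 2) t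
      ≤ ∫ t in Ioi 0, (1 - ∏ i, Real.cos (c i * t)) / t ^ 2 := by
    rw [← integral_sub (integrableOn_one_sub_exp v hv0) htail]
    refine setIntegral_mono_on ((integrableOn_one_sub_exp v hv0).sub htail) hint
      measurableSet_Ioi fun t (ht : 0 < t) => ?_
    have ht2 : 0 < t ^ 2 := pow_pos ht 2
    by_cases h : t ∈ Ioi (1 / 2 : ℝ)
    · rw [indicator_of_mem h]
      have h1 : (1 - Real.exp (-v * t ^ 2 / 2)) / t ^ 2 ≤ 1 / t ^ 2 :=
        div_le_div_of_nonneg_right (by linarith [Real.exp_pos (-v * t ^ 2 / 2)]) ht2.le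
      have h2 : 0 ≤ (1 - ∏ i, Real.cos (c i * t)) / t ^ 2 :=
        div_nonneg (by linarith [hprod1 t]) ht2.le
      linarith
    · rw [indicator_of_notMem h, sub_zero]
      have ht' : t ≤ 1 / 2 := not_lt.1 h
      have hu : ∀ i, |c i * t| ≤ 1 := by
        intro i
        rw [abs_mul, abs_of_pos ht]
        nlinarith [hc i, abs_nonneg (c i)]
      refine div_le_div_of_nonneg_right (sub_le_sub_left ?_ _) ht2.le
      calc ∏ i, Real.cos (c i * t) ≤ ∏ i, Real.exp (-(c i * t) ^ 2 / 2) :=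
            Finset.prod_le_prod (fun i _ => (Real.cos_pos_of_le_one (hu i)).le)
              fun i _ => cos_le_exp_neg_sq_div_two (hu i)
        _ = Real.exp (-v * t ^ 2 / 2) := by
            rw [← Real.exp_sum, hv]
            congr 1
            rw [← Finset.sum_neg_distrib, Finset.sum_mul, Finset.sum_div]
            exact Finset.sum_congr rfl fun i _ => by ring
  have ht2 : ∫ t in Ioi (0 : ℝ), (Ioi (1 / 2 : ℝ)).indicator (fun t : ℝ => 1 / t ^ 2) t = 2 := by
    rw [setIntegral_indicator measurableSet_Ioi, Ioi_inter_Ioi,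
      max_eq_right (by norm_num), integral_inv_sq (by norm_num)]
    norm_num
  rw [integral_one_sub_exp v hv0, ht2, ← hI] at hle
  have := absConst_pos
  rw [sub_le_iff_le_add, ← mul_le_mul_iff_left₀ this, add_mul, div_mul_cancel₀ _ this.ne']
  linarith

/-- A maximal inequality: exponential moment bounds for a finite family control the expectation of
any random selection from the family. -/
lemma expect_select_le {Ω I : Type*} [Fintype Ω] [Nonempty Ω] [Fintype I] [Nonempty I]
    (Y : I → Ω → ℝ) (sel : Ω → I) {l b : ℝ} (hl : 0 < l)
    (h : ∀ i, 𝔼 w, Real.exp (l * Y i w) ≤ Real.exp b) :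
    𝔼 w, Y (sel w) w ≤ (Real.log (Fintype.card I) + b) / l := by
  set L := Real.log (Fintype.card I) + b with hL
  have hcard : (0 : ℝ) < Fintype.card I := by exact_mod_cast Fintype.card_pos
  -- The bound y + 1 ≤ exp y replaces Jensen's inequality; the exponential of the selected member is
  -- then at most the sum over the whole family.
  have h1 : 𝔼 w, (l * Y (sel w) w - L + 1) ≤ 𝔼 w, ∑ i, Real.exp (l * Y i w) * Real.exp (-L) := by
    refine Finset.expect_le_expect fun w _ => (Real.add_one_le_exp _).trans ?_
    rw [sub_eq_add_neg, Real.exp_add]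
    exact Finset.single_le_sum (f := fun i => Real.exp (l * Y i w) * Real.exp (-L))
      (fun i _ => by positivity) (Finset.mem_univ (sel w))
  have h2 : 𝔼 w, ∑ i, Real.exp (l * Y i w) * Real.exp (-L) ≤ 1 := by
    rw [Finset.expect_sum_comm]
    simp_rw [← Finset.expect_mul]
    calc ∑ i, (𝔼 w, Real.exp (l * Y i w)) * Real.exp (-L)
        ≤ ∑ _i : I, Real.exp b * Real.exp (-L) :=
          Finset.sum_le_sum fun i _ => mul_le_mul_of_nonneg_right (h i) (Real.exp_pos _).le
      _ = 1 := by
          rw [Finset.sum_const, Finset.card_univ, nsmul_eq_mul, ← Real.exp_add, hL,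
            neg_add_rev, add_neg_cancel_left, Real.exp_neg, Real.exp_log hcard,
            mul_inv_cancel₀ hcard.ne']
  rw [Finset.expect_add_distrib, Finset.expect_sub_distrib, ← Finset.mul_expect,
    Fintype.expect_const, Fintype.expect_const] at h1
  rw [le_div_iff₀ hl]
  linarith

lemma expect_exp_sum_le {ι : Type*} [Fintype ι] [DecidableEq ι] (c : ι → ℝ) (l : ℝ)
    (hc : ∀ i, c i ^ 2 ≤ 1) :
    𝔼 e : ι → ℤˣ, Real.exp (l * ∑ i, sgn (e i) * c i)
      ≤ Real.exp (Fintype.card ι * (l ^ 2 / 2)) := by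
  have h := expect_prod (fun (i : ι) (u : ℤˣ) => Real.exp (l * (sgn u * c i)))
  simp_rw [← Real.exp_sum, ← Finset.mul_sum] at h
  rw [h, ← nsmul_eq_mul, ← Finset.card_univ, ← Finset.sum_const, Real.exp_sum]
  refine Finset.prod_le_prod (fun i _ => Finset.expect_nonneg fun _ _ => (Real.exp_pos _).le)
    fun i _ => ?_
  rw [expect_intUnits]
  have h1 := Real.cosh_le_exp_half_sq (l * c i)
  rw [Real.cosh_eq] at h1
  refine le_trans ?_ (h1.trans (Real.exp_le_exp.2 ?_))
  · simp [sgn]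
  · rw [mul_pow]
    nlinarith [hc i, sq_nonneg l]

/-- The variance proxy is the true variance 3/16 of Bernoulli(3/4). This works only for l ≥ 0: the
third cumulant is negative, so the bound fails for small negative l. -/
lemma bernoulli_mgf_le {l : ℝ} (hl : 0 ≤ l) :
    (1 + 3 * Real.exp l) / 4 ≤ Real.exp (3 * l / 4 + 3 * l ^ 2 / 32) := by
  let φ : ℝ → ℝ := fun x => 3 * x / 4 + 3 * x ^ 2 / 32 - Real.log ((1 + 3 * Real.exp x) / 4)
  have hpos : ∀ x, 0 < (1 + 3 * Real.exp x) / 4 := fun x => by positivity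
  have hd : ∀ x, HasDerivAt φ (3 / 4 + 3 * x / 16 - 3 * Real.exp x / (1 + 3 * Real.exp x)) x := by
    intro x
    have h1 : HasDerivAt (fun x => (1 + 3 * Real.exp x) / 4) (3 * Real.exp x / 4) x :=
      (((Real.hasDerivAt_exp x).const_mul 3).const_add 1).div_const 4
    have h2 := ((((hasDerivAt_id x).const_mul 3).div_const 4).add
      ((((hasDerivAt_pow 2 x)).const_mul 3).div_const 32)).sub (h1.log (hpos x).ne')
    refine h2.congr_deriv ?_
    have := Real.exp_pos x
    field_simp
    ring
  have hmono : MonotoneOn φ (Ici 0) := by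
    refine monotoneOn_of_deriv_nonneg (convex_Ici 0)
      (fun x _ => (hd x).continuousAt.continuousWithinAt)
      (fun x _ => (hd x).differentiableAt.differentiableWithinAt) fun x hx => ?_
    rw [interior_Ici] at hx
    have hx : 0 < x := hx
    rw [(hd x).deriv, sub_nonneg, div_le_iff₀ (by positivity)]
    have he := Real.exp_pos x
    -- The derivative condition reads exp x * (4 - 3x) ≤ 4 + x. For x ≤ 2 it follows from (4 + x)(1
    -- - x/2)² = 4 - 3x + x³/4 and exp x * (1 - x/2)² ≤ 1; for x > 2 the left side is negative.
    rcases le_or_gt x 2 with h2x | h2x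
    · have h1 : 1 - x / 2 ≤ Real.exp (-(x / 2)) := by linarith [Real.add_one_le_exp (-(x / 2))]
      have h2 : Real.exp x * (1 - x / 2) ^ 2 ≤ 1 := by
        calc Real.exp x * (1 - x / 2) ^ 2 ≤ Real.exp x * Real.exp (-(x / 2)) ^ 2 := by
              gcongr
              linarith
          _ = 1 := by rw [← Real.exp_nat_mul, ← Real.exp_add]; simp; ring
      have h3 : 0 ≤ Real.exp x * x ^ 3 := by positivity
      nlinarith [mul_le_mul_of_nonneg_left h2 (by linarith : 0 ≤ 4 + x)]
    · nlinarith [mul_pos he (by linarith : 0 < x - 2)]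
  have h0 : φ 0 = 0 := by simp [φ]; norm_num
  have := hmono (by simp) hl hl
  rw [h0] at this
  rw [← Real.exp_log (hpos l)]
  exact Real.exp_le_exp.2 (sub_nonneg.1 this)

end Max2Sat

/-! ### Formulas as signed multigraphs, and the multilinear extension. -/

namespace Max2Sat

open scoped BigOperators

/-- A pair of distinct variables, listed in increasing order. -/
abbrev Edge (n : ℕ) : Type := {p : Fin n × Fin n // p.1 < p.2}

/-- The truth value encoded by a sign. -/
def unitBool (u : ℤˣ) : Bool := decide (u = 1)

lemma unitBool_injective : Function.Injective unitBool := by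
  intro u v h
  rcases Int.units_eq_one_or u with rfl | rfl <;> rcases Int.units_eq_one_or v with rfl | rfl <;>
    simp_all [unitBool]

lemma unitBool_surjective (b : Bool) : ∃ u, unitBool u = b := by
  cases b
  · exact ⟨-1, by decide⟩
  · exact ⟨1, by decide⟩

/-- The clause with variables `e` and literals of signs `u`, `v`. -/
def mkClause {n : ℕ} (e : Edge n) (u v : ℤˣ) : Clause n :=
  ⟨{(e.1.1, unitBool u), (e.1.2, unitBool v)}, by
    have hne := e.2.ne
    refine ⟨Finset.card_pair fun h => hne (congrArg Prod.fst h), ?_⟩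
    intro a ha b hb hab
    simp only [Finset.mem_insert, Finset.mem_singleton] at ha hb
    rcases ha with rfl | rfl <;> rcases hb with rfl | rfl
    · rfl
    · exact absurd hab hne
    · exact absurd hab.symm hne
    · rfl⟩

lemma mkClause_bijective (n : ℕ) :
    Function.Bijective fun p : Edge n × ℤˣ × ℤˣ => mkClause p.1 p.2.1 p.2.2 := by
  constructor
  · rintro ⟨⟨⟨a, b⟩, hab⟩, u, v⟩ ⟨⟨⟨a', b'⟩, hab'⟩, u', v'⟩ h
    simp only [mkClause, Subtype.mk.injEq] at h
    have h' : ({(a, unitBool u), (b, unitBool v)} : Set (Literal n))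
        = {(a', unitBool u'), (b', unitBool v')} := by
      have := congrArg (fun s : Finset (Literal n) => (s : Set (Literal n))) h
      simpa using this
    rw [Set.pair_eq_pair_iff] at h'
    simp only [Prod.mk.injEq] at h'
    dsimp only at hab hab'
    rcases h' with ⟨⟨rfl, hu⟩, rfl, hv⟩ | ⟨⟨rfl, hu⟩, rfl, hv⟩
    · rw [unitBool_injective hu, unitBool_injective hv]
    · exact absurd hab (lt_asymm hab')
  · rintro ⟨C, hC, hp⟩
    obtain ⟨x, y, hxy, rfl⟩ := Finset.card_eq_two.1 hC
    have hne : x.1 ≠ y.1 := fun h => hxy (hp x (by simp) y (by simp) h)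
    obtain ⟨u, hu⟩ := unitBool_surjective x.2
    obtain ⟨v, hv⟩ := unitBool_surjective y.2
    rcases lt_or_gt_of_ne hne with h | h
    · refine ⟨(⟨(x.1, y.1), h⟩, u, v), Subtype.ext ?_⟩
      simp [mkClause, hu, hv]
    · refine ⟨(⟨(y.1, x.1), h⟩, v, u), Subtype.ext ?_⟩
      simp [mkClause, hu, hv, Finset.pair_comm]

/-- A choice of signs for the first and for the second literal of each of `m` clauses. -/
abbrev Signs (m : ℕ) : Type := (Fin m → ℤˣ) × (Fin m → ℤˣ)

/-- The formula with underlying multigraph `g` and signs `σ`. -/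
def mkFormula {n m : ℕ} (g : Fin m → Edge n) (σ : Signs m) : Formula n m :=
  fun j => mkClause (g j) (σ.1 j) (σ.2 j)

lemma mkFormula_bijective (n m : ℕ) :
    Function.Bijective fun p : (Fin m → Edge n) × Signs m => mkFormula p.1 p.2 := by
  constructor
  · rintro ⟨g, s, t⟩ ⟨g', s', t'⟩ h
    have h' : ∀ j, (g j, s j, t j) = (g' j, s' j, t' j) := fun j =>
      (mkClause_bijective n).1 (congrFun h j)
    simp only [Prod.mk.injEq] at h' ⊢
    exact ⟨funext fun j => (h' j).1, funext fun j => (h' j).2.1, funext fun j => (h' j).2.2⟩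
  · intro F
    choose p hp using fun j => (mkClause_bijective n).2 (F j)
    exact ⟨(fun j => (p j).1, fun j => (p j).2.1, fun j => (p j).2.2), funext hp⟩

lemma expect_prod_type {α β : Type*} [Fintype α] [Fintype β] (f : α × β → ℝ) :
    𝔼 p, f p = 𝔼 a, 𝔼 b, f (a, b) := by
  rw [← Finset.univ_product_univ, Finset.expect_product]

lemma expectedMax_eq (n m : ℕ) :
    expectedMax n m = 𝔼 g : Fin m → Edge n, 𝔼 σ : Signs m, (maxSat (mkFormula g σ) : ℝ) := by
  rw [← expect_prod_type fun p : (Fin m → Edge n) × Signs m => (maxSat (mkFormula p.1 p.2) : ℝ),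
    expectedMax, ← Fintype.expect_eq_sum_div_card]
  exact (Fintype.expect_bijective _ (mkFormula_bijective n m) _ _ fun _ => rfl).symm

/-- The truth value of `b` as a sign. -/
def boolSgn (b : Bool) : ℝ := if b then 1 else -1

/-- The multilinear extension of the number of satisfied clauses: the expected number of satisfied
clauses when the variables are independent with means `x i`. -/
noncomputable def phi {n m : ℕ} (g : Fin m → Edge n) (σ : Signs m) (x : Fin n → ℝ) : ℝ :=
  ∑ j, (1 - (1 - sgn (σ.1 j) * x (g j).1.1) * (1 - sgn (σ.2 j) * x (g j).1.2) / 4)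

lemma satisfies_mkClause {n : ℕ} (X : Fin n → Bool) (e : Edge n) (u v : ℤˣ) :
    (if Satisfies X (mkClause e u v) then (1 : ℝ) else 0)
      = 1 - (1 - sgn u * boolSgn (X e.1.1)) * (1 - sgn v * boolSgn (X e.1.2)) / 4 := by
  have h : Satisfies X (mkClause e u v) ↔ X e.1.1 = unitBool u ∨ X e.1.2 = unitBool v := by
    simp [Satisfies, mkClause]
  simp only [h]
  rcases Int.units_eq_one_or u with rfl | rfl <;> rcases Int.units_eq_one_or v with rfl | rfl <;>
    cases X e.1.1 <;> cases X e.1.2 <;> norm_num [unitBool, boolSgn, sgn]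

lemma numSat_mkFormula {n m : ℕ} (g : Fin m → Edge n) (σ : Signs m) (X : Fin n → Bool) :
    (numSat (mkFormula g σ) X : ℝ) = phi g σ fun i => boolSgn (X i) := by
  rw [numSat, phi, Finset.card_filter]
  push_cast
  exact Finset.sum_congr rfl fun j _ => satisfies_mkClause X (g j) (σ.1 j) (σ.2 j)

/-- Four times the derivative of `phi` in direction `k`. -/
noncomputable def grad {n m : ℕ} (g : Fin m → Edge n) (σ : Signs m) (x : Fin n → ℝ) (k : Fin n) :
    ℝ :=
  ∑ j, ((if (g j).1.1 = k then sgn (σ.1 j) * (1 - sgn (σ.2 j) * x (g j).1.2) else 0)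
    + if (g j).1.2 = k then sgn (σ.2 j) * (1 - sgn (σ.1 j) * x (g j).1.1) else 0)

/-- The two variables of a clause are distinct, so `phi` is affine in each coordinate. -/
lemma phi_update {n m : ℕ} (g : Fin m → Edge n) (σ : Signs m) (x : Fin n → ℝ) (k : Fin n)
    (hk : x k = 0) (v : ℝ) :
    phi g σ (Function.update x k v) = phi g σ x + v * grad g σ x k / 4 := by
  rw [phi, phi, grad, Finset.mul_sum, Finset.sum_div, ← Finset.sum_add_distrib]
  refine Finset.sum_congr rfl fun j _ => ?_
  have hne := (g j).2.ne
  by_cases h1 : (g j).1.1 = k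
  · have h2 : (g j).1.2 ≠ k := fun h => hne (h1.trans h.symm)
    rw [h1, Function.update_self, Function.update_of_ne h2, if_pos rfl, if_neg h2, hk]
    ring
  · by_cases h2 : (g j).1.2 = k
    · rw [h2, Function.update_self, Function.update_of_ne h1, if_pos rfl, if_neg h1, hk]
      ring
    · rw [Function.update_of_ne h1, Function.update_of_ne h2, if_neg h1, if_neg h2]
      ring

/-! ### The greedy assignment and resampling of signs. -/

/-- The greedy partial assignment after `k` steps; unset variables have value `0`. -/
noncomputable def greedy {n m : ℕ} (g : Fin m → Edge n) (σ : Signs m) : ℕ → Fin n → ℝ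
  | 0 => 0
  | k + 1 => if h : k < n then
      Function.update (greedy g σ k) ⟨k, h⟩ (if 0 ≤ grad g σ (greedy g σ k) ⟨k, h⟩ then 1 else -1)
    else greedy g σ k

section Greedy

variable {n m : ℕ} (g : Fin m → Edge n) (σ : Signs m)

lemma greedy_succ (k : Fin n) :
    greedy g σ (k + 1) = Function.update (greedy g σ k) k
      (if 0 ≤ grad g σ (greedy g σ k) k then 1 else -1) := by
  rw [greedy, dif_pos k.2]

lemma greedy_unset {k : ℕ} {i : Fin n} (h : k ≤ i) : greedy g σ k i = 0 := by
  induction k with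
  | zero => rfl
  | succ k ih =>
    rw [greedy_succ g σ ⟨k, by omega⟩, Function.update_of_ne]
    · exact ih (by omega)
    · intro h'; rw [h'] at h; simp at h

lemma greedy_stable {k : ℕ} {i : Fin n} (h : (i : ℕ) < k) :
    greedy g σ k i = greedy g σ (i + 1) i := by
  induction k with
  | zero => omega
  | succ k ih =>
    rcases (Nat.lt_succ_iff.1 h).lt_or_eq with h' | h'
    · rw [← ih h', greedy]
      split_ifs with hk
      all_goals try rfl
      all_goals
        rw [Function.update_of_ne]
        intro h''; rw [h''] at h'; simp at h'
    · rw [h']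

lemma greedy_set {k : ℕ} {i : Fin n} (h : (i : ℕ) < k) :
    greedy g σ k i = 1 ∨ greedy g σ k i = -1 := by
  rw [greedy_stable g σ h, greedy_succ, Function.update_self]
  split_ifs <;> simp

lemma greedy_eq_final {k : ℕ} {i : Fin n} (h : (i : ℕ) < k) :
    greedy g σ k i = greedy g σ n i := by
  rw [greedy_stable g σ h, greedy_stable g σ i.2]

lemma phi_greedy_succ (k : Fin n) :
    phi g σ (greedy g σ (k + 1)) = phi g σ (greedy g σ k) + |grad g σ (greedy g σ k) k| / 4 := by
  rw [greedy_succ, phi_update _ _ _ _ (greedy_unset g σ le_rfl)]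
  split_ifs with h
  · rw [abs_of_nonneg h, one_mul]
  · rw [abs_of_neg (not_le.1 h), neg_one_mul]

/-- The gains telescope from the all-zero point, which represents a uniformly random assignment and
satisfies 3/4 of the clauses on average. -/
lemma phi_greedy :
    phi g σ (greedy g σ n) = 3 / 4 * m + ∑ k : Fin n, |grad g σ (greedy g σ k) k| / 4 := by
  let f : ℕ → ℝ := fun k => phi g σ (greedy g σ (k + 1)) - phi g σ (greedy g σ k)
  have h1 : ∑ k : Fin n, |grad g σ (greedy g σ k) k| / 4 = ∑ k : Fin n, f k :=
    Finset.sum_congr rfl fun k _ => by simp only [f]; rw [phi_greedy_succ]; ring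
  rw [h1, Fin.sum_univ_eq_sum_range, Finset.sum_range_sub (fun k => phi g σ (greedy g σ k))]
  have h0 : phi g σ (greedy g σ 0) = 3 / 4 * m := by
    simp [phi, greedy]; ring
  rw [h0]; ring

lemma phi_greedy_le_maxSat : phi g σ (greedy g σ n) ≤ maxSat (mkFormula g σ) := by
  have h : greedy g σ n = fun i => boolSgn (decide (greedy g σ n i = 1)) := by
    funext i
    rcases greedy_set g σ i.2 with h | h <;> rw [h] <;> norm_num [boolSgn]
  rw [h, ← numSat_mkFormula]
  exact_mod_cast Finset.le_sup (f := fun X => numSat (mkFormula g σ) X) (Finset.mem_univ _)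

lemma sgn_mul (u v : ℤˣ) : sgn (u * v) = sgn u * sgn v := by
  simp [sgn]

/-- Multiplication of the signs at the occurrences of variable `k` by `e`. -/
def flipAt (k : Fin n) (e : Fin m → ℤˣ) : Signs m :=
  (fun j => (if (g j).1.1 = k then e j else 1) * σ.1 j,
    fun j => (if (g j).1.2 = k then e j else 1) * σ.2 j)

/-- Signs at k enter the derivative at i only multiplied by x k, which vanishes. Hence the greedy
choices before k do not see them. -/
lemma grad_flipAt_of_lt {k i : Fin n} (hik : i < k) (e : Fin m → ℤˣ) {x : Fin n → ℝ}
    (hx : x k = 0) : grad g (flipAt g σ k e) x i = grad g σ x i := by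
  refine Finset.sum_congr rfl fun j _ => ?_
  have hlt := (g j).2
  congr 1
  · by_cases h : (g j).1.1 = i
    · have h1 : (g j).1.1 ≠ k := h ▸ hik.ne
      rw [if_pos h, if_pos h]
      by_cases h2 : (g j).1.2 = k
      · simp [flipAt, h1, h2, hx]
      · simp [flipAt, h1, h2]
    · rw [if_neg h, if_neg h]
  · by_cases h : (g j).1.2 = i
    · have h1 : (g j).1.1 ≠ k := (hlt.trans (h ▸ hik)).ne
      have h2 : (g j).1.2 ≠ k := h ▸ hik.ne
      simp [flipAt, h1, h2]
    · rw [if_neg h, if_neg h]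

lemma greedy_flipAt {k : Fin n} {l : ℕ} (hl : l ≤ k) (e : Fin m → ℤˣ) :
    greedy g (flipAt g σ k e) l = greedy g σ l := by
  induction l with
  | zero => rfl
  | succ l ih =>
    have h := ih (by omega)
    have hl' : l < n := by omega
    rw [greedy_succ g _ ⟨l, hl'⟩, greedy_succ g _ ⟨l, hl'⟩]
    simp only
    rw [h, grad_flipAt_of_lt g σ (by rw [Fin.lt_def]; exact hl) e (greedy_unset g σ (by omega))]

/-- The weight with which clause `j` enters `grad`. -/
noncomputable def weight (x : Fin n → ℝ) (k : Fin n) (j : Fin m) : ℝ :=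
  (if (g j).1.1 = k then sgn (σ.1 j) * (1 - sgn (σ.2 j) * x (g j).1.2) else 0)
    + if (g j).1.2 = k then sgn (σ.2 j) * (1 - sgn (σ.1 j) * x (g j).1.1) else 0

lemma grad_flipAt_self (x : Fin n → ℝ) (k : Fin n) (e : Fin m → ℤˣ) :
    grad g (flipAt g σ k e) x k = ∑ j, sgn (e j) * weight g σ x k j := by
  refine Finset.sum_congr rfl fun j _ => ?_
  have hne := (g j).2.ne
  by_cases h1 : (g j).1.1 = k
  · have h2 : (g j).1.2 ≠ k := fun h => hne (h1.trans h.symm)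
    simp only [weight, flipAt, h1, h2, if_true, if_false, sgn_mul, one_mul]
    ring
  · by_cases h2 : (g j).1.2 = k
    · simp only [weight, flipAt, h1, h2, if_true, if_false, sgn_mul, one_mul]
      ring
    · simp [weight, h1, h2]

/-- The part of the conditional variance that depends on the multigraph only. -/
def degWeight (k : Fin n) : ℝ :=
  ∑ j, ((if (g j).1.1 = k then 1 else 0) + if (g j).1.2 = k then 2 else 0)

/-- The bias of the signs of the earlier literals in the clauses whose later variable is `k`. -/
noncomputable def bias (k : Fin n) : ℝ :=
  ∑ j, if (g j).1.2 = k then sgn (σ.1 j) * greedy g σ n (g j).1.1 else 0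

/-- If k is the earlier variable of the clause, the other one is still unset and the weight is ±1.
If k is the later one, the other literal has value s = ±1 and (1 - s)² = 2 - 2s: a false literal
doubles the weight, a true one kills it. -/
lemma weight_sq (k : Fin n) (j : Fin m) :
    weight g σ (greedy g σ k) k j ^ 2 =
      ((if (g j).1.1 = k then 1 else 0) + if (g j).1.2 = k then 2 else 0)
        - 2 * if (g j).1.2 = k then sgn (σ.1 j) * greedy g σ n (g j).1.1 else 0 := by
  have hlt := (g j).2
  by_cases h1 : (g j).1.1 = k
  · have h2 : (g j).1.2 ≠ k := fun h => hlt.ne (h1.trans h.symm)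
    have h3 : greedy g σ k (g j).1.2 = 0 := greedy_unset g σ (by
      rw [← h1]; exact (Fin.lt_def.1 hlt).le)
    simp only [weight, if_pos h1, if_neg h2, h3]
    linear_combination sgn_sq (σ.1 j)
  · by_cases h2 : (g j).1.2 = k
    · have h3 : ((g j).1.1 : ℕ) < k := by rw [← h2]; exact hlt
      simp only [weight, if_neg h1, if_pos h2, greedy_eq_final g σ h3]
      have h4 : greedy g σ n (g j).1.1 ^ 2 = 1 := by
        rcases greedy_set g σ (g j).1.1.2 with h | h <;> rw [h] <;> norm_num
      rw [zero_add, mul_pow, sgn_sq]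
      linear_combination greedy g σ n (g j).1.1 ^ 2 * sgn_sq (σ.1 j) + h4
    · simp [weight, h1, h2]

lemma sum_weight_sq (k : Fin n) :
    ∑ j, weight g σ (greedy g σ k) k j ^ 2 = degWeight g k - 2 * bias g σ k := by
  rw [degWeight, bias, Finset.mul_sum, ← Finset.sum_sub_distrib]
  exact Finset.sum_congr rfl fun j _ => weight_sq g σ k j

lemma abs_weight_le (k : Fin n) (j : Fin m) : |weight g σ (greedy g σ k) k j| ≤ 2 := by
  rw [← sq_le_sq₀ (abs_nonneg _) (by norm_num), sq_abs, weight_sq]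
  have h : |sgn (σ.1 j) * greedy g σ n (g j).1.1| ≤ 1 := by
    rcases greedy_set g σ (g j).1.1.2 with h | h <;> rw [h] <;>
      rcases Int.units_eq_one_or (σ.1 j) with h' | h' <;> rw [h'] <;> simp [sgn]
  have h' := (abs_le.1 h).1
  have hne := (g j).2.ne
  by_cases h1 : (g j).1.1 = k
  · have h2 : (g j).1.2 ≠ k := fun h => hne (h1.trans h.symm)
    norm_num [h1, h2]
  · split_ifs <;> linarith

lemma flipAt_bijective (k : Fin n) (e : Fin m → ℤˣ) :
    Function.Bijective fun σ : Signs m => flipAt g σ k e := by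
  refine Function.Involutive.bijective fun σ => ?_
  refine Prod.ext (funext fun j => ?_) (funext fun j => ?_) <;> simp only [flipAt]
  · rw [← mul_assoc, Int.units_mul_self, one_mul]
  · rw [← mul_assoc, Int.units_mul_self, one_mul]

/-- Flipping by a fixed e permutes the sign patterns, so an extra average over e changes nothing.
With σ fixed, the weights do not depend on e and Khintchine's inequality applies to the inner
average. -/
lemma le_expect_abs_grad (k : Fin n) :
    𝔼 σ : Signs m, (Real.sqrt (2 / Real.pi) * Real.sqrt (degWeight g k - 2 * bias g σ k)
        - 2 / absConst)
      ≤ 𝔼 σ : Signs m, |grad g σ (greedy g σ k) k| := by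
  have h : 𝔼 σ : Signs m, |grad g σ (greedy g σ k) k|
      = 𝔼 σ : Signs m, 𝔼 e : Fin m → ℤˣ, |∑ j, sgn (e j) * weight g σ (greedy g σ k) k j| := by
    rw [Finset.expect_comm]
    have h' : ∀ e : Fin m → ℤˣ,
        𝔼 σ : Signs m, |∑ j, sgn (e j) * weight g σ (greedy g σ k) k j|
          = 𝔼 σ : Signs m, |grad g σ (greedy g σ k) k| := fun e =>
      Fintype.expect_bijective _ (flipAt_bijective g k e) _ _ fun σ => by
        rw [greedy_flipAt g σ le_rfl, grad_flipAt_self]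
    simp_rw [h']
    rw [Fintype.expect_const]
  rw [h]
  refine Finset.expect_le_expect fun σ _ => ?_
  rw [← sum_weight_sq]
  exact le_expect_abs_sum _ (abs_weight_le g σ k)

end Greedy

end Max2Sat

/-! ### The upper bound and the total bias. -/

namespace Max2Sat

open scoped BigOperators

lemma expect_le_of_forall_le {ι : Type*} [Fintype ι] [Nonempty ι] {f : ι → ℝ} {a : ℝ}
    (h : ∀ i, f i ≤ a) : 𝔼 i, f i ≤ a := by
  rw [← Fintype.expect_const (ι := ι) a]
  exact Finset.expect_le_expect fun i _ => h i

lemma expect_exp_phi {n m : ℕ} (g : Fin m → Edge n) (X : Fin n → Bool) (l : ℝ) :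
    𝔼 σ : Signs m, Real.exp (l * phi g σ fun i => boolSgn (X i))
      = ((1 + 3 * Real.exp l) / 4) ^ m := by
  let h : Fin m → ℤˣ → ℤˣ → ℝ := fun j u v =>
    Real.exp (l * (1 - (1 - sgn u * boolSgn (X (g j).1.1)) * (1 - sgn v * boolSgn (X (g j).1.2)) / 4))
  have h1 : ∀ σ : Signs m, Real.exp (l * phi g σ fun i => boolSgn (X i))
      = ∏ j, h j (σ.1 j) (σ.2 j) := by
    intro σ
    rw [phi, Finset.mul_sum, Real.exp_sum]
  simp_rw [h1]
  rw [expect_prod_type]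
  have h2 : ∀ s : Fin m → ℤˣ, 𝔼 t : Fin m → ℤˣ, ∏ j, h j (s j) (t j)
      = ∏ j, 𝔼 v, h j (s j) v := fun s => expect_prod fun j v => h j (s j) v
  simp only [h2]
  rw [expect_prod fun j u => 𝔼 v, h j u v]
  have h3 : ∀ j, 𝔼 u, 𝔼 v, h j u v = (1 + 3 * Real.exp l) / 4 := by
    intro j
    simp only [expect_intUnits, h]
    cases X (g j).1.1 <;> cases X (g j).1.2 <;> norm_num [boolSgn, sgn] <;> ring
  rw [Finset.prod_congr rfl fun j _ => h3 j]
  simp [div_pow]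

lemma expectedMax_le {n m : ℕ} [Nonempty (Edge n)] (hn : 0 < n) (hm : 0 < m) :
    expectedMax n m ≤ 3 / 4 * m + Real.sqrt (3 * Real.log 2 / 8) * Real.sqrt (n * m) := by
  rw [expectedMax_eq]
  refine expect_le_of_forall_le fun g => ?_
  have hn' : (0 : ℝ) < n := by exact_mod_cast hn
  have hm' : (0 : ℝ) < m := by exact_mod_cast hm
  have hlog : 0 < Real.log 2 := Real.log_pos (by norm_num)
  have hsel : ∀ σ : Signs m, ∃ X : Fin n → Bool,
      numSat (mkFormula g σ) X = maxSat (mkFormula g σ) := fun σ => by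
    obtain ⟨X, -, hX⟩ := Finset.exists_mem_eq_sup Finset.univ Finset.univ_nonempty
      fun X => numSat (mkFormula g σ) X
    exact ⟨X, hX.symm⟩
  choose sel hsel using hsel
  -- The optimal exponent, balancing the entropy n log 2 against the quadratic term 3 m l² / 32.
  set l := Real.sqrt (32 * n * Real.log 2 / (3 * m)) with hl
  have hl0 : 0 < l := Real.sqrt_pos.2 (by positivity)
  have hl2 : l ^ 2 = 32 * n * Real.log 2 / (3 * m) := Real.sq_sqrt (by positivity)
  have h := expect_select_le (fun X (σ : Signs m) => phi g σ fun i => boolSgn (X i)) sel hl0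
    (b := m * (3 * l / 4 + 3 * l ^ 2 / 32)) fun X => by
      rw [expect_exp_phi, Real.exp_nat_mul]
      exact pow_le_pow_left₀ (by positivity) (bernoulli_mgf_le hl0.le) m
  simp_rw [← numSat_mkFormula, hsel] at h
  refine h.trans (le_of_eq ?_)
  have hs : Real.sqrt (3 * Real.log 2 / 8) * Real.sqrt (n * m) = 3 * m * l / 16 := by
    rw [← Real.sqrt_mul (by positivity), Real.sqrt_eq_iff_mul_self_eq (by positivity) (by positivity)]
    have : 3 * m * l / 16 * (3 * m * l / 16) = 9 * m ^ 2 / 256 * l ^ 2 := by ring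
    rw [this, hl2]
    field_simp
    ring
  rw [hs, div_eq_iff hl0.ne']
  have hcard : Real.log (Fintype.card (Fin n → Bool)) = n * Real.log 2 := by
    simp [Real.log_pow]
  rw [hcard]
  have h2 : n * Real.log 2 = 3 * m / 32 * l ^ 2 := by
    rw [hl2]; field_simp
  rw [h2]
  ring

/-- The greedy values depend on the signs, so the biases are not sums of independent terms. A union
bound over all 4^n pairs of sign vectors, one standing for the greedy assignment and one for the
signs of the biases, removes the dependence. -/
lemma expect_sum_abs_bias_le {n m : ℕ} (g : Fin m → Edge n) (hn : 0 < n) (hm : 0 < m) :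
    𝔼 σ : Signs m, ∑ k, |bias g σ k| ≤ 2 * Real.sqrt (n * m) := by
  have hn' : (0 : ℝ) < n := by exact_mod_cast hn
  have hm' : (0 : ℝ) < m := by exact_mod_cast hm
  let Y : (Fin n → ℤˣ) × (Fin n → ℤˣ) → Signs m → ℝ := fun p σ =>
    ∑ j, sgn (σ.1 j) * (sgn (p.1 (g j).1.1) * sgn (p.2 (g j).1.2))
  let sel : Signs m → (Fin n → ℤˣ) × (Fin n → ℤˣ) := fun σ =>
    (fun i => if greedy g σ n i = 1 then 1 else -1, fun k => if 0 ≤ bias g σ k then 1 else -1)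
  have h1 : ∀ σ, ∑ k, |bias g σ k| = Y (sel σ) σ := by
    intro σ
    have ha : ∀ k, |bias g σ k| = ∑ j, if (g j).1.2 = k then
        sgn (σ.1 j) * (sgn ((sel σ).1 (g j).1.1) * sgn ((sel σ).2 (g j).1.2)) else 0 := by
      intro k
      have hb : |bias g σ k| = sgn ((sel σ).2 k) * bias g σ k := by
        simp only [sel]
        split_ifs with h
        · simp [sgn, abs_of_nonneg h]
        · simp [sgn, abs_of_neg (not_le.1 h)]
      rw [hb, bias, Finset.mul_sum]
      refine Finset.sum_congr rfl fun j _ => ?_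
      have hc : sgn ((sel σ).1 (g j).1.1) = greedy g σ n (g j).1.1 := by
        simp only [sel]
        rcases greedy_set g σ (g j).1.1.2 with h | h <;> rw [h] <;> norm_num [sgn]
      split_ifs with h
      · rw [hc, h]; ring
      · ring
    simp_rw [ha, Y]
    rw [Finset.sum_comm]
    simp
  simp_rw [h1]
  -- With l = √(n/m) the maximal inequality gives (2 log 2 + 1/2)√(nm), and 2 log 2 + 1/2 < 2.
  set l := Real.sqrt (n * m) / m with hl
  have hl0 : 0 < l := by positivity
  have hss : Real.sqrt (n * m) * Real.sqrt (n * m) = n * m := Real.mul_self_sqrt (by positivity)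
  have h := expect_select_le Y sel hl0 (b := m * (l ^ 2 / 2)) fun p => by
    rw [expect_prod_type]
    simp only [Y, Fintype.expect_const]
    have := expect_exp_sum_le (fun j => sgn (p.1 (g j).1.1) * sgn (p.2 (g j).1.2)) l
      fun j => by rw [mul_pow, sgn_sq, sgn_sq, one_mul]
    simpa using this
  refine h.trans ?_
  rw [div_le_iff₀ hl0]
  have hcard : Real.log (Fintype.card ((Fin n → ℤˣ) × (Fin n → ℤˣ))) = 2 * n * Real.log 2 := by
    simp [Real.log_mul, Real.log_pow]
    ring
  have h2 : m * l ^ 2 = n := by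
    rw [hl, div_pow, sq (Real.sqrt _), hss]; field_simp
  have h3 : Real.sqrt (n * m) * l = n := by
    rw [hl, mul_div_assoc', hss]; field_simp
  rw [hcard, mul_assoc 2 (Real.sqrt _), h3]
  nlinarith [Real.log_two_lt_d9]

/-! ### Moments of the weighted degrees, and assembly of the lower bound. -/

lemma expect_eval {m : ℕ} {α : Type*} [Fintype α] [Nonempty α] (q : α → ℝ) (i : Fin m) :
    𝔼 g : Fin m → α, q (g i) = 𝔼 a, q a := by
  have h := expect_prod fun (l : Fin m) (a : α) => if l = i then q a else 1
  have h2 : ∀ l, 𝔼 a, (if l = i then q a else 1) = if l = i then 𝔼 a, q a else 1 := by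
    intro l
    split_ifs <;> simp
  simp_rw [h2] at h
  simpa using h

lemma expect_eval_mul_eval {m : ℕ} {α : Type*} [Fintype α] [Nonempty α] (q : α → ℝ)
    (hq : 𝔼 a, q a = 0) {i j : Fin m} (hij : i ≠ j) :
    𝔼 g : Fin m → α, q (g i) * q (g j) = 0 := by
  have h := expect_prod fun (l : Fin m) (a : α) =>
    (if l = i then q a else 1) * (if l = j then q a else 1)
  rw [Finset.prod_eq_zero (Finset.mem_univ i) (by simp [hij, hq])] at h
  simp_rw [Finset.prod_mul_distrib, Finset.prod_ite_eq', Finset.mem_univ, if_true] at h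
  exact h

lemma expect_sum_sub_sq_le {m : ℕ} {α : Type*} [Fintype α] [Nonempty α] (p : α → ℝ) :
    𝔼 g : Fin m → α, (∑ j, p (g j) - m * 𝔼 a, p a) ^ 2 ≤ m * 𝔼 a, p a ^ 2 := by
  set M := 𝔼 a, p a with hM
  let q : α → ℝ := fun a => p a - M
  have hq : 𝔼 a, q a = 0 := by
    simp only [q]
    rw [Finset.expect_sub_distrib, Fintype.expect_const, sub_self]
  have h1 : ∀ g : Fin m → α, (∑ j, p (g j) - m * M) ^ 2 = ∑ i, ∑ j, q (g i) * q (g j) := by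
    intro g
    rw [← Finset.sum_mul_sum, ← sq]
    simp [q]
  simp_rw [h1]
  rw [Finset.expect_sum_comm]
  have h2 : ∀ i : Fin m, 𝔼 g : Fin m → α, ∑ j, q (g i) * q (g j) = 𝔼 a, q a ^ 2 := by
    intro i
    rw [Finset.expect_sum_comm, Finset.sum_eq_single i]
    · simp_rw [← sq]
      exact expect_eval (fun a => q a ^ 2) i
    · intro j _ hj
      exact expect_eval_mul_eval q hq hj.symm
    · simp
  simp_rw [h2]
  rw [Finset.sum_const, Finset.card_univ, Fintype.card_fin, nsmul_eq_mul]
  refine mul_le_mul_of_nonneg_left ?_ (Nat.cast_nonneg m)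
  have h3 : ∀ a, q a ^ 2 = p a ^ 2 - 2 * M * q a - M ^ 2 := by
    intro a; simp only [q]; ring
  simp_rw [h3]
  rw [Finset.expect_sub_distrib, Finset.expect_sub_distrib, ← Finset.mul_expect, hq,
    Fintype.expect_const]
  nlinarith [sq_nonneg M]

lemma sum_edge {n : ℕ} (f : Fin n × Fin n → ℝ) :
    ∑ e : Edge n, f e.1 = ∑ a, ∑ b, if a < b then f (a, b) else 0 := by
  rw [← Fintype.sum_prod_type' (f := fun a b => if a < b then f (a, b) else 0), ← Finset.sum_filter]
  exact (Finset.sum_subtype _ (by simp) f).symm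

lemma card_edge (n : ℕ) : (Fintype.card (Edge n) : ℝ) = n * (n - 1) / 2 := by
  have h := sum_edge (n := n) fun _ => 1
  rw [Finset.sum_comm] at h
  simp only [Finset.sum_const, Finset.card_univ, nsmul_eq_mul, mul_one, Finset.sum_boole] at h
  rw [h]
  have h1 : ∀ b : Fin n, ((Finset.univ.filter fun a => a < b).card : ℝ) = ((b : ℕ) : ℝ) := by
    intro b
    rw [Finset.filter_gt_eq_Iio, Fin.card_Iio]
  simp_rw [h1]
  rw [Fin.sum_univ_eq_sum_range (fun i => (i : ℝ)), ← Nat.cast_sum, eq_div_iff (by norm_num)]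
  have h2 := Finset.sum_range_id_mul_two n
  rcases n with _ | n
  · simp
  · have h3 : ((∑ i ∈ Finset.range (n + 1), i : ℕ) : ℝ) * 2 = (n + 1) * n := by exact_mod_cast h2
    rw [h3]; push_cast; ring

/-- The contribution of an edge to `degWeight`. -/
def edgeWeight {n : ℕ} (k : Fin n) (e : Edge n) : ℝ :=
  (if e.1.1 = k then 1 else 0) + if e.1.2 = k then 2 else 0

/-- The expectation of `degWeight` over a random multigraph. -/
noncomputable def meanDeg (n m : ℕ) (k : ℕ) : ℝ := 2 * m * (n - 1 + k) / (n * (n - 1))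

/-- Variable k is the earlier end of n - 1 - k pairs (weight 1) and the later end of k pairs (weight
2). -/
lemma expect_edgeWeight {n : ℕ} (m : ℕ) (k : Fin n) :
    m * 𝔼 e, edgeWeight k e = meanDeg n m k := by
  rw [Fintype.expect_eq_sum_div_card, card_edge]
  have h : ∑ e, edgeWeight k e = n - 1 + (k : ℕ) := by
    simp only [edgeWeight]
    rw [Finset.sum_add_distrib, sum_edge fun p => if p.1 = k then (1 : ℝ) else 0,
      sum_edge fun p => if p.2 = k then (2 : ℝ) else 0, Finset.sum_comm (γ := Fin n)]
    have h1 : ∑ b : Fin n, ∑ a : Fin n, (if a < b then if a = k then (1 : ℝ) else 0 else 0)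
        = n - 1 - (k : ℕ) := by
      have : ∀ b a : Fin n, (if a < b then if a = k then (1 : ℝ) else 0 else 0)
          = if a = k then if k < b then 1 else 0 else 0 := by
        intro b a; by_cases h : a = k <;> simp [h]
      simp_rw [this]
      simp only [Finset.sum_ite_eq', Finset.mem_univ, if_true, Finset.sum_boole]
      have hk := k.2
      have hc : (Finset.univ.filter fun b => k < b).card = n - 1 - k := by
        rw [Finset.filter_lt_eq_Ioi, Fin.card_Ioi]
      rw [hc, Nat.cast_sub (by omega), Nat.cast_sub (by omega), Nat.cast_one]
    have h2 : ∑ a : Fin n, ∑ b : Fin n, (if a < b then if b = k then (2 : ℝ) else 0 else 0)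
        = 2 * (k : ℕ) := by
      have : ∀ a b : Fin n, (if a < b then if b = k then (2 : ℝ) else 0 else 0)
          = if b = k then if a < k then 2 else 0 else 0 := by
        intro a b; by_cases h : b = k <;> simp [h]
      simp_rw [this]
      simp only [Finset.sum_ite_eq', Finset.mem_univ, if_true]
      rw [← Finset.sum_filter, Finset.sum_const, Finset.filter_gt_eq_Iio, Fin.card_Iio, nsmul_eq_mul, mul_comm]
    rw [h1, h2]; ring
  rw [h, meanDeg, ← mul_div_assoc, div_div_eq_mul_div]
  ring

/-- Edge weights lie in {0, 1, 2}, so their squares are at most twice themselves. -/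
lemma expect_degWeight_sub_sq_le {n m : ℕ} [Nonempty (Edge n)] (k : Fin n) :
    𝔼 g : Fin m → Edge n, (degWeight g k - meanDeg n m k) ^ 2 ≤ 2 * meanDeg n m k := by
  rw [← expect_edgeWeight]
  refine (expect_sum_sub_sq_le (m := m) (edgeWeight k)).trans ?_
  rw [mul_left_comm, Finset.mul_expect Finset.univ (edgeWeight k) (2 : ℝ)]
  refine mul_le_mul_of_nonneg_left (Finset.expect_le_expect (α := ℝ) fun e _ => ?_)
    (Nat.cast_nonneg m)
  have hne := e.2.ne
  rw [edgeWeight]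
  by_cases h1 : e.1.1 = k
  · have h2 : e.1.2 ≠ k := fun h => hne (h1.trans h.symm)
    norm_num [h1, h2]
  · split_ifs <;> norm_num

/-- From |√V - √a| ≤ |V - a| / √a. The degree fluctuation P - a is made quadratic by AM-GM, so that
a variance bound of order a costs O(1); the bias T stays linear, since only its absolute sum is
controlled. -/
lemma sqrt_sub_le_sqrt {a V P T : ℝ} (ha : 0 < a) (hV : 0 ≤ V) (h : V = P - 2 * T) :
    Real.sqrt a - (P - a) ^ 2 / (2 * a) - 1 / 2 - 2 * |T| / Real.sqrt a ≤ Real.sqrt V := by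
  set r := Real.sqrt a with hr
  have hr0 : 0 < r := Real.sqrt_pos.2 ha
  have hra : r ^ 2 = a := Real.sq_sqrt ha.le
  have hs := Real.sqrt_nonneg V
  have hs2 : Real.sqrt V ^ 2 = V := Real.sq_sqrt hV
  have h1 : r - |V - a| / r ≤ Real.sqrt V := by
    rw [sub_le_iff_le_add, ← sub_le_iff_le_add', le_div_iff₀ hr0]
    rcases le_or_gt r (Real.sqrt V) with h' | h'
    · exact (mul_nonpos_of_nonpos_of_nonneg (by linarith) hr0.le).trans (abs_nonneg _)
    · refine le_trans ?_ (neg_le_abs _)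
      nlinarith
  have h2 : |V - a| ≤ |P - a| + 2 * |T| := by
    rw [h]
    have h2 := abs_add_le (P - a) (-(2 * T))
    rw [abs_neg, abs_mul, abs_two] at h2
    rwa [show P - 2 * T - a = P - a + -(2 * T) by ring]
  have h3 : |V - a| / r ≤ |P - a| / r + 2 * |T| / r := by
    rw [← add_div]; exact div_le_div_of_nonneg_right h2 hr0.le
  have h4 : |P - a| / r ≤ (P - a) ^ 2 / (2 * a) + 1 / 2 := by
    have := two_mul_le_add_sq (|P - a| / r) 1
    rw [div_pow, sq_abs, hra] at this
    have h5 : (P - a) ^ 2 / (2 * a) = (P - a) ^ 2 / a / 2 := by rw [div_div, mul_comm]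
    rw [h5]; linarith
  linarith

/-- The linear error constant in the lower bound. -/
noncomputable def errConst : ℝ := 2 * Real.sqrt (2 / Real.pi) + 2 / absConst

lemma le_expectedMax {n m : ℕ} (hn : 2 ≤ n) (hm : 0 < m) :
    3 / 4 * m + Real.sqrt (2 / Real.pi) / 4 * ∑ k : Fin n, Real.sqrt (meanDeg n m k)
      - errConst * n ≤ expectedMax n m := by
  have : Nonempty (Edge n) := ⟨⟨(⟨0, by omega⟩, ⟨1, by omega⟩), by simp [Fin.lt_def]⟩⟩
  have hn' : (2 : ℝ) ≤ n := by exact_mod_cast hn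
  have hm' : (0 : ℝ) < m := by exact_mod_cast hm
  set A := Real.sqrt (2 / Real.pi) with hA
  have hA0 : 0 ≤ A := Real.sqrt_nonneg _
  set C := 2 / absConst with hC
  -- A lower bound for every √`meanDeg`, uniform in k, so that the biases can be summed before being
  -- estimated.
  set r := Real.sqrt (2 * m / n) with hr
  have hr0 : 0 < r := Real.sqrt_pos.2 (by positivity)
  have hmean : ∀ k : Fin n, 2 * m / n ≤ meanDeg n m k := by
    intro k
    rw [meanDeg, div_le_div_iff₀ (by linarith) (by nlinarith)]
    have : (0 : ℝ) ≤ m * n * (k : ℕ) := by positivity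
    nlinarith
  have hmean0 : ∀ k : Fin n, 0 < meanDeg n m k := fun k => lt_of_lt_of_le (by positivity) (hmean k)
  have hrk : ∀ k : Fin n, r ≤ Real.sqrt (meanDeg n m k) := fun k => Real.sqrt_le_sqrt (hmean k)
  -- the bound for a fixed multigraph
  have hfix : ∀ g : Fin m → Edge n,
      3 / 4 * m + ∑ k : Fin n, (A * (Real.sqrt (meanDeg n m k)
        - (degWeight g k - meanDeg n m k) ^ 2 / (2 * meanDeg n m k) - 1 / 2) - C) / 4
        - A * n ≤ 𝔼 σ : Signs m, (maxSat (mkFormula g σ) : ℝ) := by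
    intro g
    have hb : 𝔼 σ : Signs m, ∑ k, |bias g σ k| / r ≤ 2 * n := by
      simp_rw [← Finset.sum_div]
      rw [← Finset.expect_div, div_le_iff₀ hr0]
      refine (expect_sum_abs_bias_le g (by omega) hm).trans ?_
      have : Real.sqrt (n * m) ≤ n * r := by
        rw [Real.sqrt_le_iff]
        refine ⟨by positivity, ?_⟩
        rw [mul_pow, hr, Real.sq_sqrt (by positivity)]
        have : (n : ℝ) ^ 2 * (2 * m / n) = 2 * (n * m) := by field_simp
        rw [this]
        nlinarith [mul_pos (by linarith : (0 : ℝ) < n) hm']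
      linarith
    have haff : ∀ (K : ℝ) (f : Signs m → ℝ), 𝔼 σ, (A * (K - 2 * f σ / r) - C) / 4
        = (A * K - C) / 4 - A / 2 * 𝔼 σ, f σ / r := by
      intro K f
      have h : ∀ σ, (A * (K - 2 * f σ / r) - C) / 4 = (A * K - C) / 4 - A / 2 * (f σ / r) := by
        intro σ; ring
      simp_rw [h]
      rw [Finset.expect_sub_distrib, Fintype.expect_const, ← Finset.mul_expect]
    calc _ ≤ 3 / 4 * m + ∑ k : Fin n, (A * (Real.sqrt (meanDeg n m k)
        - (degWeight g k - meanDeg n m k) ^ 2 / (2 * meanDeg n m k) - 1 / 2) - C) / 4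
        - A / 2 * 𝔼 σ : Signs m, ∑ k, |bias g σ k| / r := by nlinarith
      _ = 3 / 4 * m + ∑ k : Fin n, 𝔼 σ : Signs m, (A * (Real.sqrt (meanDeg n m k)
        - (degWeight g k - meanDeg n m k) ^ 2 / (2 * meanDeg n m k) - 1 / 2
        - 2 * |bias g σ k| / r) - C) / 4 := by
          rw [Finset.expect_sum_comm, Finset.mul_sum, add_sub_assoc, ← Finset.sum_sub_distrib]
          congr 1
          refine Finset.sum_congr rfl fun k _ => ?_
          exact (haff _ _).symm
      _ ≤ 3 / 4 * m + ∑ k : Fin n, 𝔼 σ : Signs m, (A *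
          Real.sqrt (degWeight g k - 2 * bias g σ k) - C) / 4 := by
          gcongr with k _ σ _
          have hV : 0 ≤ degWeight g k - 2 * bias g σ k := by
            rw [← sum_weight_sq]; exact Finset.sum_nonneg fun _ _ => sq_nonneg _
          refine le_trans ?_ (sqrt_sub_le_sqrt (hmean0 k) hV rfl)
          gcongr
          exact hrk k
      _ ≤ 3 / 4 * m + ∑ k : Fin n, 𝔼 σ : Signs m, |grad g σ (greedy g σ k) k| / 4 := by
          gcongr 3 / 4 * m + ∑ k : Fin n, ?_ with k _
          rw [← Finset.expect_div, ← Finset.expect_div]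
          exact div_le_div_of_nonneg_right (le_expect_abs_grad g k) (by norm_num)
      _ = 𝔼 σ : Signs m, phi g σ (greedy g σ n) := by
          simp_rw [phi_greedy]
          rw [Finset.expect_add_distrib, Fintype.expect_const, Finset.expect_sum_comm]
      _ ≤ _ := Finset.expect_le_expect fun σ _ => phi_greedy_le_maxSat g σ
  rw [expectedMax_eq]
  refine le_trans ?_ (Finset.expect_le_expect fun g _ => hfix g)
  rw [Finset.expect_sub_distrib, Finset.expect_add_distrib, Fintype.expect_const,
    Fintype.expect_const, Finset.expect_sum_comm]
  -- The 3/8 is (1 + 1/2)/4: at most 1 from the normalised variance and 1/2 from AM-GM.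
  have hk : ∀ k : Fin n, A / 4 * Real.sqrt (meanDeg n m k) - (3 / 8 * A + C / 4) ≤
      𝔼 g : Fin m → Edge n, (A * (Real.sqrt (meanDeg n m k)
        - (degWeight g k - meanDeg n m k) ^ 2 / (2 * meanDeg n m k) - 1 / 2) - C) / 4 := by
    intro k
    have h1 := expect_degWeight_sub_sq_le (m := m) k
    have h2 : 𝔼 g : Fin m → Edge n, (degWeight g k - meanDeg n m k) ^ 2 / (2 * meanDeg n m k)
        ≤ 1 := by
      rw [← Finset.expect_div, div_le_one (by linarith [hmean0 k])]
      exact h1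
    rw [← Finset.expect_div, Finset.expect_sub_distrib, ← Finset.mul_expect,
      Finset.expect_sub_distrib, Finset.expect_sub_distrib, Fintype.expect_const,
      Fintype.expect_const, Fintype.expect_const]
    nlinarith
  have hsum := Finset.sum_le_sum fun k (_ : k ∈ Finset.univ) => hk k
  rw [Finset.sum_sub_distrib, ← Finset.mul_sum, Finset.sum_const, Finset.card_univ,
    Fintype.card_fin, nsmul_eq_mul] at hsum
  have hC0 : 0 < C := div_pos two_pos absConst_pos
  have he : errConst = 2 * A + C := rfl
  rw [he]
  nlinarith [mul_nonneg hA0 (by linarith : (0 : ℝ) ≤ n), mul_pos hC0 (by linarith : (0 : ℝ) < n)]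

end Max2Sat

/-! ### The Riemann sum giving the leading coefficient. -/

namespace Max2Sat

lemma sum_sqrt_ge (n : ℕ) :
    2 / 3 * (Real.sqrt 8 - 1) * (n * Real.sqrt n) - Real.sqrt n
      ≤ ∑ k : Fin n, Real.sqrt (n + (k : ℕ)) := by
  have hstep : ∀ x : ℝ, 0 ≤ x → 2 / 3 * ((x + 1) * Real.sqrt (x + 1) - x * Real.sqrt x)
      ≤ Real.sqrt (x + 1) := by
    intro x hx
    have ha := Real.sqrt_nonneg x
    have hb := Real.sqrt_nonneg (x + 1)
    have ha2 := Real.sq_sqrt hx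
    have hb2 := Real.sq_sqrt (by linarith : 0 ≤ x + 1)
    set a := Real.sqrt x
    set b := Real.sqrt (x + 1)
    have hx' : x = a ^ 2 := ha2.symm
    have h1 : b ^ 2 = a ^ 2 + 1 := by linarith
    rw [← hb2, hx']
    -- As b² - a² = 1, the difference 3b - 2(b³ - a³) equals (b - a)²(2a + b).
    nlinarith [mul_nonneg (sq_nonneg (a - b)) (by linarith : 0 ≤ 2 * a + b)]
  have hind : ∀ N : ℕ, 2 / 3 * ((n + N) * Real.sqrt (n + N) - n * Real.sqrt n)
      ≤ ∑ k ∈ Finset.range N, Real.sqrt (n + (k : ℕ) + 1) := by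
    intro N
    induction N with
    | zero => simp
    | succ N ih =>
      rw [Finset.sum_range_succ]
      have := hstep (n + N) (by positivity)
      push_cast
      rw [← add_assoc]
      linarith
  have h := hind n
  -- Passing from right to left endpoints costs √(2n) - √n ≤ √n.
  have htel : ∑ k ∈ Finset.range n, Real.sqrt (n + (k : ℕ) + 1)
      - ∑ k ∈ Finset.range n, Real.sqrt (n + (k : ℕ)) = Real.sqrt (n + n) - Real.sqrt n := by
    rw [← Finset.sum_sub_distrib]
    have := Finset.sum_range_sub (fun k : ℕ => Real.sqrt (n + k)) n
    simp only [Nat.cast_add, Nat.cast_one, Nat.cast_zero, add_zero, ← add_assoc] at this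
    exact this
  rw [Fin.sum_univ_eq_sum_range (fun k => Real.sqrt (n + (k : ℕ)))]
  have h2 : Real.sqrt (n + n) = Real.sqrt 2 * Real.sqrt n := by
    rw [← two_mul, Real.sqrt_mul (by norm_num)]
  have h8 : Real.sqrt 8 = 2 * Real.sqrt 2 := by
    rw [show (8 : ℝ) = 2 ^ 2 * 2 by norm_num, Real.sqrt_mul (by norm_num), Real.sqrt_sq (by norm_num)]
  rw [h2] at h htel
  rw [h8]
  have h3 : Real.sqrt 2 ≤ 2 := by rw [Real.sqrt_le_iff]; norm_num
  nlinarith [Real.sqrt_nonneg (n : ℝ), mul_le_mul_of_nonneg_right h3 (Real.sqrt_nonneg (n : ℝ))]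

/-- The coefficient of `√c n` in the lower bound. -/
noncomputable def lowerCoeff : ℝ := (Real.sqrt 8 - Real.sqrt 1) / (3 * Real.sqrt Real.pi)

lemma lowerCoeff_pos : 0 < lowerCoeff := by
  have : Real.sqrt 1 < Real.sqrt 8 := Real.sqrt_lt_sqrt (by norm_num) (by norm_num)
  have := Real.sqrt_pos.2 Real.pi_pos
  exact div_pos (by linarith) (by linarith)

lemma le_sum_sqrt_meanDeg {n m : ℕ} (hn : 2 ≤ n) :
    lowerCoeff * Real.sqrt (m * n) - Real.sqrt (m / n)
      ≤ Real.sqrt (2 / Real.pi) / 4 * ∑ k : Fin n, Real.sqrt (meanDeg n m k) := by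
  have hn' : (2 : ℝ) ≤ n := by exact_mod_cast hn
  have hn0 : (0 : ℝ) < n := by linarith
  have hsn : 0 < Real.sqrt n := Real.sqrt_pos.2 hn0
  have hnn : Real.sqrt n * Real.sqrt n = n := Real.mul_self_sqrt hn0.le
  have hsp : 0 < Real.sqrt Real.pi := Real.sqrt_pos.2 Real.pi_pos
  have h22 : Real.sqrt 2 * Real.sqrt 2 = 2 := Real.mul_self_sqrt (by norm_num)
  have hterm : ∀ k : Fin n, Real.sqrt 2 * Real.sqrt m / n * Real.sqrt (n + (k : ℕ))
      ≤ Real.sqrt (meanDeg n m k) := by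
    intro k
    refine Real.le_sqrt_of_sq_le ?_
    rw [mul_pow, div_pow, mul_pow, Real.sq_sqrt (by norm_num), Real.sq_sqrt (by positivity),
      Real.sq_sqrt (by positivity), meanDeg, div_mul_eq_mul_div,
      div_le_div_iff₀ (by positivity) (by nlinarith)]
    have : (0 : ℝ) ≤ m * n * (k : ℕ) := by positivity
    nlinarith
  have h1 := Finset.sum_le_sum fun k (_ : k ∈ Finset.univ) => hterm k
  rw [← Finset.mul_sum] at h1
  have h2 := mul_le_mul_of_nonneg_left (sum_sqrt_ge n)
    (by positivity : 0 ≤ Real.sqrt 2 * Real.sqrt m / n)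
  have h3 := mul_le_mul_of_nonneg_left (h2.trans h1)
    (by positivity : 0 ≤ Real.sqrt (2 / Real.pi) / 4)
  refine le_trans (le_of_sub_nonneg ?_) h3
  rw [lowerCoeff, Real.sqrt_mul (by positivity), Real.sqrt_div (by positivity),
    Real.sqrt_div (by norm_num), Real.sqrt_one]
  have h4 : Real.sqrt 2 / Real.sqrt Real.pi / 4 * (Real.sqrt 2 * Real.sqrt m / n *
      (2 / 3 * (Real.sqrt 8 - 1) * (n * Real.sqrt n) - Real.sqrt n))
      - ((Real.sqrt 8 - 1) / (3 * Real.sqrt Real.pi) * (Real.sqrt m * Real.sqrt n)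
        - Real.sqrt m / Real.sqrt n)
      = Real.sqrt m / Real.sqrt n * (1 - 1 / (2 * Real.sqrt Real.pi)) := by
    clear h1 h2 h3 hterm
    generalize Real.sqrt n = q at *
    rw [← hnn]
    field_simp
    rw [sq (Real.sqrt 2), h22]
    ring
  rw [h4]
  refine mul_nonneg (by positivity) (sub_nonneg.2 ?_)
  rw [div_le_one (by positivity)]
  have : 1 ≤ Real.sqrt Real.pi := Real.one_le_sqrt.2 (by linarith [Real.pi_gt_three])
  linarith

lemma asympLE_of_eventually_le {u v : ℕ → ℝ} (hv : ∀ᶠ n in atTop, 0 < v n)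
    (h : ∀ᶠ n in atTop, u n ≤ v n) : AsympLE u v := by
  refine ⟨hv, limsup_le_of_le (by isBoundedDefault) ?_⟩
  filter_upwards [hv, h] with n h1 h2
  exact_mod_cast (div_le_one h1).2 h2

end Max2Sat

/-! ### Choice of constants and rounding. -/

theorem mainTheorem3 :
    ∃ K c₀ : ℝ, 0 < c₀ ∧ ∀ c : ℝ, c₀ ≤ c →
      Max2Sat.AsympLE
        (fun n : ℕ => (Real.sqrt c * ((Real.sqrt 8 - Real.sqrt 1) / (3 * Real.sqrt Real.pi)) - K)
          * (n : ℝ))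
        (fun n : ℕ => Max2Sat.expectedMax n ⌊c * (n : ℝ)⌋₊ - 3 / 4 * c * (n : ℝ)) ∧
      Max2Sat.AsympLE
        (fun n : ℕ => Max2Sat.expectedMax n ⌊c * (n : ℝ)⌋₊ - 3 / 4 * c * (n : ℝ))
        (fun n : ℕ => Real.sqrt c * Real.sqrt (3 * Real.log 2 / 8) * (n : ℝ)) := by
  have hα := Max2Sat.lowerCoeff_pos
  -- The extra 1 gives slack n, absorbing the rounding and lower-order loss 3/4 + `lowerCoeff` + √c
  -- for large n.
  set K := Max2Sat.errConst + 1 with hK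
  set c₁ := (|K| + 1) / Max2Sat.lowerCoeff with hc₁
  have hc₁0 : 0 < c₁ := by positivity
  refine ⟨K, max 1 (c₁ ^ 2), lt_max_of_lt_left one_pos, fun c hc => ?_⟩
  have hc1 : 1 ≤ c := (le_max_left _ _).trans hc
  have hs1 : 1 ≤ Real.sqrt c := Real.one_le_sqrt.2 hc1
  have hcc : Real.sqrt c ^ 2 = c := Real.sq_sqrt (by linarith)
  -- This is what fixes c₀: a positive lower coefficient makes the excess over 3cn/4 eventually
  -- positive, as `AsympLE` demands of its comparison sequence.
  have hs : 1 ≤ Real.sqrt c * Max2Sat.lowerCoeff - K := by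
    have h1 : c₁ ≤ Real.sqrt c := Real.le_sqrt_of_sq_le ((le_max_right _ _).trans hc)
    rw [hc₁, div_le_iff₀ hα] at h1
    linarith [le_abs_self K]
  have hfloor : ∀ n : ℕ, (⌊c * (n : ℝ)⌋₊ : ℝ) ≤ c * n := fun n => Nat.floor_le (by positivity)
  have hmpos : ∀ n : ℕ, 2 ≤ n → 0 < ⌊c * (n : ℝ)⌋₊ := by
    intro n hn
    have hn' : (2 : ℝ) ≤ n := by exact_mod_cast hn
    exact Nat.floor_pos.2 (by nlinarith)
  have hlow : ∀ᶠ n : ℕ in atTop, (Real.sqrt c * Max2Sat.lowerCoeff - K) * (n : ℝ)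
      ≤ Max2Sat.expectedMax n ⌊c * (n : ℝ)⌋₊ - 3 / 4 * c * (n : ℝ) := by
    filter_upwards [eventually_ge_atTop 2,
      eventually_ge_atTop ⌈1 + Max2Sat.lowerCoeff + Real.sqrt c⌉₊] with n hn hn2
    have hn' : (2 : ℝ) ≤ n := by exact_mod_cast hn
    have hn2' := Nat.ceil_le.1 hn2
    set m := ⌊c * (n : ℝ)⌋₊ with hm
    have h1 := Max2Sat.le_expectedMax hn (hmpos n hn)
    have h2 := Max2Sat.le_sum_sqrt_meanDeg (m := m) hn
    have h3 : c * n - 1 < m := Nat.sub_one_lt_floor _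
    have h4 : Real.sqrt (m / n) ≤ Real.sqrt c :=
      Real.sqrt_le_sqrt ((div_le_iff₀ (by linarith)).2 (hfloor n))
    have h5 : Real.sqrt c * n - 1 ≤ Real.sqrt (m * n) := by
      refine Real.le_sqrt_of_sq_le ?_
      have e1 : (Real.sqrt c * n - 1) ^ 2 = c * n ^ 2 - 2 * Real.sqrt c * n + 1 := by
        rw [sub_sq, mul_pow, hcc]; ring
      rw [e1]
      nlinarith
    have h6 := mul_le_mul_of_nonneg_left h5 hα.le
    nlinarith
  refine ⟨Max2Sat.asympLE_of_eventually_le ?_ hlow, Max2Sat.asympLE_of_eventually_le ?_ ?_⟩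
  · filter_upwards [hlow, eventually_ge_atTop 1] with n h1 h2
    have h3 : (1 : ℝ) ≤ n := by exact_mod_cast h2
    nlinarith
  · filter_upwards [eventually_ge_atTop 1] with n h2
    have h3 : (1 : ℝ) ≤ n := by exact_mod_cast h2
    have := Real.log_pos (by norm_num : (1 : ℝ) < 2)
    positivity
  · filter_upwards [eventually_ge_atTop 2] with n hn
    have : Nonempty (Max2Sat.Edge n) :=
      ⟨⟨(⟨0, by omega⟩, ⟨1, by omega⟩), by simp [Fin.lt_def]⟩⟩
    have h1 := Max2Sat.expectedMax_le (n := n) (by omega) (hmpos n hn)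
    have h2 : Real.sqrt (n * (⌊c * (n : ℝ)⌋₊ : ℝ)) ≤ Real.sqrt c * n := by
      rw [Real.sqrt_le_iff]
      refine ⟨by positivity, ?_⟩
      rw [mul_pow, hcc]
      nlinarith [mul_le_mul_of_nonneg_left (hfloor n) (Nat.cast_nonneg (α := ℝ) n)]
    have h3 := mul_le_mul_of_nonneg_left h2 (Real.sqrt_nonneg (3 * Real.log 2 / 8))
    linarith [hfloor n]
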